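/- Let $(\mathcal X,\Sigma)$ be a measurable space, $\mathcal Y=\{1,\dots,n\}$, and let $\mathcal F\subseteq([0,1]^n)^{\mathcal X}$ be a class of vector-valued score functions. For each $\mathbf f\in\mathcal F$ let $h_{\mathbf f}(\mathbf x)\in\operatorname{argmax}_{i} f_i(\mathbf x)$ be the associated classifier (ties broken by an arbitrary rule), assumed measurable. Write $\mu(\mathbf f(\mathbf x),y)=f_y(\mathbf x)-\max_{j\ne y}f_j(\mathbf x)$ for the margin. For a distribution $\mathcal D$ on $\mathcal X\times\mathcal Y$ and a sample $S\in(\mathcal X\times\mathcal Y)^m$ put $$R_{\mathcal D}(h)=\Pr_{(\mathbf x,y)\sim\mathcal D}[h(\mathbf x)\ne y],\qquad R^\gamma_S(\mathbf f)=\frac1m\sum_{(\mathbf x,y)\in S}\mathbf 1[\mu(\mathbf f(\mathbf x),y)<\gamma].$$ For integers $0\le k<m\le M$ and $\delta\in(0,1)$ let $$\mathrm{Hyp}(k,m,K,M)=\sum_{j=0}^k\binom Kj\binom{M-K}{m-j}\Big/\binom Mm,\qquad \overline{\mathrm{Hyp}}(k,m,\delta,M)=\min\{K\in\{0,\dots,M\}:\mathrm{Hyp}(k,m,K,M)\le\delta\}.$$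 For $p\ge1$ and $c>0$ let $\mathcal N^p_{\mathcal F}(c,N)=\max_{\mathbf x_1,\dots,\mathbf x_N\in\mathcal X}\mathcal N^p\big(c,\{(\mathbf f(\mathbf x_1),\dots,\mathbf f(\mathbf x_N)):\mathbf f\in\mathcal F\}\big)$, where $\mathcal N^p(c,W)$ is the least cardinality of a set $\widehat W\subseteq W\subseteq\mathbb R^{n\times N}$ such that each $w\in W$ has some $\widehat w\in\widehat W$ with $\max_{i\le N}\|w_i-\widehat w_i\|_p<c$ ($w_i$ denotes the $i$-th column). Then for every distribution $\mathcal D$ on $\mathcal X\times\mathcal Y$, all $\delta\in(0,1)$, $\gamma\in(0,1)$, $p\ge1$ and all integers $m,m'>0$, $$\Pr_{S\sim\mathcal D^m}\big[\forall\,\mathbf f\in\mathcal F:\ R_{\mathcal D}(h_{\mathbf f})\le\epsilon(mR^\gamma_S(\mathbf f),m,\delta)\big]>1-\delta,$$ where $\epsilon(m,m,\delta)=1$ and, for $k<m$, $$\epsilon(k,m,\delta)=\frac1{m'}\max\Big\{1,\ \overline{\mathrm{Hyp}}\Big(k,m,\frac{\delta}{4\,\mathcal N^p_{\mathcal F}\big(\gamma/2^{2-1/p},\,m+m'\big)},m+m'\Big)-1-k\Big\}.$$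 Here the class is assumed to be measurable in the usual sense: for all $E,G\subseteq\{1,\dots,m+m'\}$, the set of samples $((\mathbf x_i,y_i))_{i\le m+m'}$ for which some $\mathbf f\in\mathcal F$ satisfies $\{i:h_{\mathbf f}(\mathbf x_i)\ne y_i\}=E$ and $\{i:\mu(\mathbf f(\mathbf x_i),y_i)<\gamma\}=G$ is measurable with respect to the completion of $\mathcal D^{m+m'}$; the probability above is the inner probability (so the event need not itself be assumed measurable). -/

import Mathlib

open MeasureTheory

noncomputable section

namespace MarginBound

/-- Hypergeometric tail `Hyp(k, m, K, M) = ∑_{j ≤ k} C(K, j) C(M - K, m - j) / C(M, m)`: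
the probability of at most `k` successes when `m` elements are drawn without replacement from
`M` elements, `K` of which are successes.  It is only used for `k < m` and `K ≤ M`, where no
natural-number subtraction truncates. -/
def hypTail (k m K M : ℕ) : ℝ :=
  ∑ j ∈ Finset.range (k + 1),
    ((K.choose j : ℝ) * ((M - K).choose (m - j) : ℝ)) / (M.choose m : ℝ)

/-- Pseudo-inverse of the hypergeometric tail in its third argument: the least number `K` of
successes in a population of size `M` with `Hyp(k, m, K, M) ≤ δ`.  For `k < m ≤ M` and `0 ≤ δ`
such a `K` exists (for instance `K = M - m + k + 1`). -/
def hypTailInv (k m : ℕ) (δ : ℝ) (M : ℕ) : ℕ :=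
  sInf {K : ℕ | K ≤ M ∧ hypTail k m K M ≤ δ}

variable {X : Type*} {n : ℕ}

/-- The margin `μ(v, y) = v_y - max_{j ≠ y} v_j` of a vector of scores `v` at the label `y`. -/
def margin (v : Fin n → ℝ) (y : Fin n) : ℝ :=
  v y - ⨆ j : {j : Fin n // j ≠ y}, v j

/-- The map `h` selects, for each `f ∈ F`, a classifier `h f` with
`h f x ∈ argmax_i f_i(x)` for all `x`; ties are broken in an arbitrary way. -/
def IsArgmaxClassifier (F : Set (X → Fin n → ℝ)) (h : (X → Fin n → ℝ) → X → Fin n) : Prop :=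
  ∀ f ∈ F, ∀ x j, f x j ≤ f x (h f x)

/-- True risk of a classifier, `R_D(h) = P_{(x, y) ∼ D}(h(x) ≠ y)`. -/
def trueRisk [MeasurableSpace X] (D : Measure (X × Fin n)) (h : X → Fin n) : ℝ :=
  D.real {z | h z.1 ≠ z.2}

/-- Empirical margin risk `R^γ_S(f) = (1/m) ∑_{(x, y) ∈ S} 1[μ(f(x), y) < γ]`. -/
def empMarginRisk {m : ℕ} (γ : ℝ) (S : Fin m → X × Fin n) (f : X → Fin n → ℝ) : ℝ :=
  (1 / (m : ℝ)) * ∑ i, Set.indicator {z : X × Fin n | margin (f z.1) z.2 < γ} 1 (S i)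

/-- The number of examples of `S` on which the margin is less than `γ`; it equals
`m R^γ_S(f)`, see `natCast_marginErrors`. -/
def marginErrors {m : ℕ} (γ : ℝ) (S : Fin m → X × Fin n) (f : X → Fin n → ℝ) : ℕ :=
  {i : Fin m | margin (f (S i).1) (S i).2 < γ}.ncard

theorem natCast_marginErrors {m : ℕ} (γ : ℝ) (S : Fin m → X × Fin n) (f : X → Fin n → ℝ) :
    (marginErrors γ S f : ℝ) = m * empMarginRisk γ S f := by
  classical
  unfold marginErrors empMarginRisk
  rcases Nat.eq_zero_or_pos m with rfl | hm
  · simp [Set.eq_empty_of_isEmpty]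
  · have hm' : (m : ℝ) ≠ 0 := by positivity
    rw [← mul_assoc, mul_one_div_cancel hm', one_mul, Set.ncard_eq_toFinset_card']
    simp [Set.indicator_apply, Finset.sum_boole]

/-- The mixed `L_p`-`L_∞` metric `ℓ(A, B) = max_i ‖a_i - b_i‖_p` on families of `N` vectors
(columns) of `ℝ^n`. -/
def mixedDist {N : ℕ} (p : ℝ) (A B : Fin N → Fin n → ℝ) : ℝ :=
  ⨆ i, (∑ j, |A i j - B i j| ^ p) ^ (1 / p)

/-- `W'` is a (proper) `c`-cover of `W` for the mixed metric. -/
def IsCover {N : ℕ} (p c : ℝ) (W' W : Set (Fin N → Fin n → ℝ)) : Prop :=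
  W' ⊆ W ∧ ∀ w ∈ W, ∃ w' ∈ W', mixedDist p w w' < c

/-- The `c`-covering number of `W`: the least cardinality of a `c`-cover (`⊤` if there is no
finite one). -/
def coveringNumber {N : ℕ} (p c : ℝ) (W : Set (Fin N → Fin n → ℝ)) : ℕ∞ :=
  ⨅ (W' : Set (Fin N → Fin n → ℝ)) (_ : IsCover p c W' W), W'.encard

/-- The restriction of the class `F` to the points `x_1, …, x_N`. -/
def restriction {N : ℕ} (F : Set (X → Fin n → ℝ)) (x : Fin N → X) :
    Set (Fin N → Fin n → ℝ) :=
  (fun f i => f (x i)) '' F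

/-- The uniform covering number `N^p_F(c, N)`: the largest covering number of a restriction of
`F` to `N` points. -/
def uniformCoveringNumber (p : ℝ) (F : Set (X → Fin n → ℝ)) (c : ℝ) (N : ℕ) : ℕ∞ :=
  ⨆ x : Fin N → X, coveringNumber p c (restriction F x)

/-- The bound `ε(k, m, δ)`.  For scores in `[0, 1]` the uniform covering number is finite, so
`ENat.toNat` loses nothing. -/
def marginEps (F : Set (X → Fin n → ℝ)) (p γ : ℝ) (m' k m : ℕ) (δ : ℝ) : ℝ :=
  if k = m then 1
  else
    (1 / (m' : ℝ)) *
      max 1 ((hypTailInv k m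
        (δ / (4 * ((uniformCoveringNumber p F (γ / 2 ^ (2 - 1 / p)) (m + m')).toNat : ℝ)))
        (m + m') : ℝ) - 1 - k)

/-- Measurability of the class: for any prescribed set `E` of misclassified indices and any
prescribed set `G` of indices of margin less than `γ`, it is an event (up to `D^N`-null sets)
that some `f ∈ F` has exactly these errors and margin errors on an i.i.d. sample of size `N`.
This always holds for countable classes of measurable functions. -/
def IsSampleMeasurable [MeasurableSpace X] (F : Set (X → Fin n → ℝ))
    (h : (X → Fin n → ℝ) → X → Fin n) (γ : ℝ) (D : Measure (X × Fin n)) (N : ℕ) : Prop :=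
  ∀ E G : Set (Fin N),
    NullMeasurableSet
      {T : Fin N → X × Fin n | ∃ f ∈ F,
        {i | h f (T i).1 ≠ (T i).2} = E ∧ {i | margin (f (T i).1) (T i).2 < γ} = G}
      (Measure.pi fun _ => D)

end MarginBound

end

open MarginBound

/-! The proof is symmetrization by a ghost sample of size `m'`, followed by a covering argument and
sampling without replacement.

Suppose some `f` violates the bound on `S` and let `t = max 1 (K - 1 - k)`, where `K` is the inverse
hypergeometric tail. The true risk then exceeds `t / m'`. A binomial variable whose mean exceeds an
integer `t ≥ 1` is larger than `t` with probability more than 1/4 (`binomialCdf_lt`), so the ghost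
sample shows at least `K - k` errors of `h f` with that probability. Hence the violating samples lie
in an event of probability less than `δ` as soon as bad double samples have probability at most `δ /
4` (`exists_measurableSet_compl_of_append`).

By exchangeability it suffices to bound, for each fixed double sample, the fraction of permutations
that make it bad (`measure_le_of_card_perm_le`). The margin has Lipschitz constant `2 ^ (1 - 1/p)`
for the p-norm, so an element `w` of the cover changes margins by less than `γ / 2`. The set `H` of
indices where `w` has margin below `γ / 2` thus lies between the errors of `h f` and the `γ`-margin
errors of `f`, and the bad event for `f` implies the one for the single set `H`. For fixed `H` this
is a hypergeometric tail event (`card_filter_hypTailInv_le`), and a union bound over the cover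
finishes. -/

open MarginBound

/-! ### Binomial tails at an integral mean -/

/-- The distribution function of the binomial distribution with parameters `n` and `x` at `t`. -/
noncomputable def binomialCdf (n t : ℕ) (x : ℝ) : ℝ :=
  ∑ j ∈ Finset.range (t + 1), (n.choose j : ℝ) * x ^ j * (1 - x) ^ (n - j)

theorem binomialCdf_eq_eval (n t : ℕ) (x : ℝ) :
    binomialCdf n t x = (∑ j ∈ Finset.range (t + 1), bernsteinPolynomial ℝ n j).eval x := by
  simp [binomialCdf, bernsteinPolynomial, Polynomial.eval_finsetSum]

/-- The derivative of each Bernstein polynomial is a difference of two consecutive ones of lower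
degree, so the sum telescopes. -/
theorem derivative_sum_bernsteinPolynomial (n t : ℕ) :
    (∑ j ∈ Finset.range (t + 1), bernsteinPolynomial ℝ n j).derivative =
      -n * bernsteinPolynomial ℝ (n - 1) t := by
  induction t with
  | zero => simp [bernsteinPolynomial.derivative_zero]
  | succ t ih =>
    rw [Finset.sum_range_succ, Polynomial.derivative_add, ih, bernsteinPolynomial.derivative_succ]
    ring

theorem hasDerivAt_binomialCdf (n t : ℕ) (x : ℝ) :
    HasDerivAt (binomialCdf (n + 1) t)
      (-((n + 1 : ℝ) * n.choose t * x ^ t * (1 - x) ^ (n - t))) x := by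
  have h := (∑ j ∈ Finset.range (t + 1), bernsteinPolynomial ℝ (n + 1) j).hasDerivAt x
  rw [derivative_sum_bernsteinPolynomial] at h
  have e : binomialCdf (n + 1) t =
      fun x => (∑ j ∈ Finset.range (t + 1), bernsteinPolynomial ℝ (n + 1) j).eval x :=
    funext (binomialCdf_eq_eval _ _)
  rw [e]
  refine h.congr_deriv ?_
  simp [bernsteinPolynomial]
  ring

/-- Condition on the last trial: it spoils the event only when the first `n` trials give exactly `t`
successes and it is a success too. -/
theorem binomialCdf_succ {n t : ℕ} (ht : t ≤ n) (x : ℝ) :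
    binomialCdf (n + 1) t x =
      binomialCdf n t x - n.choose t * x ^ (t + 1) * (1 - x) ^ (n - t) := by
  induction t with
  | zero => simp [binomialCdf]; ring
  | succ t ih =>
    have ih := ih (by omega)
    unfold binomialCdf at ih ⊢
    rw [Finset.sum_range_succ, ih, Finset.sum_range_succ (n := t + 1), Nat.choose_succ_succ]
    obtain ⟨r, rfl⟩ := Nat.exists_eq_add_of_le ht
    have e1 : t + 1 + r + 1 - (t + 1) = r + 1 := by omega
    have e2 : t + 1 + r - (t + 1) = r := by omega
    have e3 : t + 1 + r - t = r + 1 := by omega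
    rw [e1, e2, e3]
    push_cast
    ring

theorem strictAntiOn_binomialCdf {n t : ℕ} (ht : t < n) :
    StrictAntiOn (binomialCdf n t) (Set.Icc 0 1) := by
  obtain ⟨n, rfl⟩ : ∃ k, n = k + 1 := ⟨n - 1, by omega⟩
  refine strictAntiOn_of_deriv_neg (convex_Icc 0 1)
    (fun x _ => (hasDerivAt_binomialCdf n t x).continuousAt.continuousWithinAt) fun x hx => ?_
  rw [interior_Icc] at hx
  rw [(hasDerivAt_binomialCdf n t x).deriv, neg_lt_zero]
  have h0 := hx.1
  have h1 : 0 < 1 - x := sub_pos.2 hx.2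
  have h2 : (0 : ℝ) < n.choose t := by exact_mod_cast Nat.choose_pos (by omega)
  positivity

/-- Keep the first term of `log ((1 + v) / (1 - v)) = 2 (v + v³/3 + ⋯)`. -/
theorem exp_two_mul_le_div {v : ℝ} (h0 : 0 ≤ v) (h1 : v < 1) :
    Real.exp (2 * v) ≤ (1 + v) / (1 - v) := by
  have hv : |v| < 1 := abs_lt.2 ⟨by linarith, h1⟩
  have hs := Real.hasSum_log_sub_log_of_abs_lt_one hv
  have h := sum_le_hasSum {0} (fun i _ => by positivity) hs
  simp at h
  rw [← Real.log_div (by linarith) (by linarith)] at h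
  rwa [← Real.le_log_iff_exp_le (div_pos (by linarith) (by linarith))]

/-- The logarithm of the left side is concave in `x`, so it lies below its tangent at `q`. -/
theorem pow_mul_pow_le_exp {q x : ℝ} (hq0 : 0 < q) (hq1 : q < 1) (hx0 : 0 ≤ x) (hx1 : x ≤ 1)
    (a b : ℕ) :
    x ^ a * (1 - x) ^ b ≤
      q ^ a * (1 - q) ^ b * Real.exp ((a / q - b / (1 - q)) * (x - q)) := by
  have key : ∀ {u y : ℝ} (c : ℕ), 0 < u → 0 ≤ y → y ^ c ≤ u ^ c * Real.exp (c / u * (y - u)) := by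
    intro u y c hu hy
    have h : y / u ≤ Real.exp ((y - u) / u) := by
      have := Real.add_one_le_exp ((y - u) / u)
      have e : (y - u) / u + 1 = y / u := by field_simp; ring
      linarith
    have h2 := pow_le_pow_left₀ (by positivity) h c
    rw [← Real.exp_nat_mul, div_pow, div_le_iff₀ (by positivity)] at h2
    calc y ^ c ≤ _ := h2
      _ = _ := by rw [mul_comm]; congr 2; ring
  have hq : 0 < 1 - q := sub_pos.2 hq1
  have hx : 0 ≤ 1 - x := sub_nonneg.2 hx1
  calc x ^ a * (1 - x) ^ b ≤ (q ^ a * Real.exp (a / q * (x - q))) *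
        ((1 - q) ^ b * Real.exp (b / (1 - q) * ((1 - x) - (1 - q)))) := by
        gcongr
        exacts [key a hq0 hx0, key b hq hx]
    _ = _ := by
        rw [mul_mul_mul_comm, ← Real.exp_add]
        congr 2
        ring

/-- This is the induction step of `binomialCdf_div_le`. Adding a trial at fixed parameter `q` lowers
the distribution function by an explicit term; moving the parameter from `q` up to `p` lowers it by
an integral, which must be shown to be no larger. The tangent bound makes the integrand exponential.
-/
theorem binomialCdf_succ_div_le {n t : ℕ} (ht0 : 0 < t) (htn : t < n) :
    binomialCdf (n + 1) t (t / (n + 1 : ℕ)) ≤ binomialCdf n t (t / n) := by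
  obtain ⟨r, rfl⟩ : ∃ r, n = t + r + 1 := ⟨n - t - 1, by omega⟩
  set q : ℝ := t / ((t + r + 1 + 1 : ℕ) : ℝ) with hq
  set p : ℝ := t / ((t + r + 1 : ℕ) : ℝ) with hp
  have ht : (0 : ℝ) < t := by exact_mod_cast ht0
  have hr : (0 : ℝ) ≤ r := r.cast_nonneg
  push_cast at hq hp
  have hq0 : 0 < q := by rw [hq]; positivity
  have hp1 : p < 1 := by rw [hp, div_lt_one (by positivity)]; linarith
  have hqp : q ≤ p := by
    rw [hq, hp]
    exact div_le_div_of_nonneg_left ht.le (by positivity) (by linarith)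
  have hq1 : q < 1 := hqp.trans_lt hp1
  have hqs : 0 < 1 - q := sub_pos.2 hq1
  -- `s` is the logarithmic derivative at `q` of `x ^ t * (1 - x) ^ r`.
  set s : ℝ := 2 * (t + r + 2) / (r + 2) with hs
  have hs0 : 0 < s := by positivity
  have hsq : (t : ℝ) / q - r / (1 - q) = s := by
    have e : 1 - q = (r + 2) / (t + r + 2) := by rw [hq]; field_simp; ring
    rw [e, hs, hq]; field_simp; ring
  set C : ℝ := ((t + r + 1).choose t : ℝ) with hC
  have hC0 : 0 < C := by
    have : 0 < (t + r + 1).choose t := Nat.choose_pos (by omega)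
    rw [hC]
    exact_mod_cast this
  have hCC : ((t + r : ℕ) + 1 : ℝ) * (t + r).choose t = C * (r + 1) := by
    have := Nat.choose_mul_succ_eq (t + r) t
    have e : t + r + 1 - t = r + 1 := by omega
    rw [e] at this
    rw [hC, mul_comm]
    exact_mod_cast this
  set c : ℝ := C * (r + 1) * (q ^ t * (1 - q) ^ r) with hc
  have hc0 : 0 < c := by positivity
  have hd (x : ℝ) : HasDerivAt (fun x => binomialCdf (t + r + 1) t x
      + c / s * Real.exp (s * (x - q)))
      (-(C * (r + 1) * (x ^ t * (1 - x) ^ r)) + c * Real.exp (s * (x - q))) x := by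
    have h1 := hasDerivAt_binomialCdf (t + r) t x
    have h2 : HasDerivAt (fun x => s * (x - q)) s x := by
      simpa using ((hasDerivAt_id x).sub_const q).const_mul s
    refine (h1.add (h2.exp.const_mul (c / s))).congr_deriv ?_
    rw [hCC, Nat.add_sub_cancel_left]
    field_simp
  -- Monotonicity of this sum replaces integrating the tangent bound over `[q, p]`.
  have hmono : MonotoneOn (fun x => binomialCdf (t + r + 1) t x
      + c / s * Real.exp (s * (x - q))) (Set.Icc 0 1) := by
    refine monotoneOn_of_deriv_nonneg (convex_Icc 0 1)
      (fun x _ => (hd x).continuousAt.continuousWithinAt)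
      (fun x _ => (hd x).differentiableAt.differentiableWithinAt) fun x hx => ?_
    rw [interior_Icc] at hx
    rw [(hd x).deriv, neg_add_eq_sub, sub_nonneg, hc, mul_assoc (C * (r + 1))]
    have := pow_mul_pow_le_exp hq0 hq1 hx.1.le hx.2.le t r
    rw [hsq] at this
    gcongr
  have h1 := hmono ⟨hq0.le, hq1.le⟩ ⟨hq0.le.trans hqp, hp1.le⟩ hqp
  simp only [sub_self, mul_zero, Real.exp_zero, mul_one] at h1
  set v : ℝ := t / ((t + r + 1) * (r + 2)) with hv
  have hv0 : 0 ≤ v := by positivity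
  have hv1 : v < 1 := by rw [hv, div_lt_one (by positivity)]; nlinarith
  have hsv : s * (p - q) = 2 * v := by rw [hs, hp, hq, hv]; field_simp; ring
  rw [hsv] at h1
  have h2 := exp_two_mul_le_div hv0 hv1
  have h3 : c / s * Real.exp (2 * v) - c / s ≤ C * q ^ (t + 1) * (1 - q) ^ (r + 1) := by
    have hv1' : 0 < 1 - v := sub_pos.2 hv1
    have e1 : 1 - q = (r + 2) / (t + r + 2) := by rw [hq]; field_simp; ring
    have e2 : 1 - v = (r + 1) * (t + r + 2) / ((t + r + 1) * (r + 2)) := by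
      rw [hv]; field_simp; ring
    calc c / s * Real.exp (2 * v) - c / s ≤ c / s * ((1 + v) / (1 - v)) - c / s := by gcongr
      _ = c * (2 * v / (1 - v) / s) := by field_simp; ring
      -- With this `v` the rational bound on the exponential yields exactly the required term;
      -- nothing is lost after it.
      _ = c * (q * (1 - q) / (r + 1)) := by
        congr 1
        rw [e1, e2, hv, hs, hq]; field_simp; ring
      _ = _ := by rw [hc]; field_simp; ring
  rw [binomialCdf_succ (by omega), show t + r + 1 - t = r + 1 by omega]
  linarith

theorem binomialCdf_succ_self (t : ℕ) (x : ℝ) :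
    binomialCdf (t + 1) t x = 1 - x ^ (t + 1) := by
  have h := add_pow x (1 - x) (t + 1)
  rw [add_sub_cancel, one_pow, Finset.sum_range_succ] at h
  simp only [Nat.choose_self, Nat.sub_self] at h
  unfold binomialCdf
  have e : ∀ j, ((t + 1).choose j : ℝ) * x ^ j * (1 - x) ^ (t + 1 - j) =
    x ^ j * (1 - x) ^ (t + 1 - j) * (t + 1).choose j := fun j => by ring
  simp only [e]
  simp at h ⊢
  linarith

/-- A binomial variable with integral mean `t`, where `0 < t < n`, exceeds its mean with
probability at least `1 / 4`. -/
theorem binomialCdf_div_le {n t : ℕ} (ht0 : 0 < t) (htn : t < n) :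
    binomialCdf n t (t / n) ≤ 3 / 4 := by
  induction n, htn using Nat.le_induction with
  | base =>
    rw [Nat.succ_eq_add_one, binomialCdf_succ_self]
    have ht : (1 : ℝ) ≤ t := by exact_mod_cast ht0
    -- Bernoulli's inequality with exponent `(t + 1) / 2`, which is at least 1 because `t ≥ 1`;
    -- squaring gives `(t / (t + 1)) ^ (t + 1) ≥ 1 / 4`.
    have h := one_add_mul_self_le_rpow_one_add (s := -1 / (t + 1 : ℝ)) (p := (t + 1) / 2)
      (by rw [le_div_iff₀ (by positivity)]; linarith) (by linarith)
    have e1 : 1 + (t + 1) / 2 * (-1 / (t + 1 : ℝ)) = 1 / 2 := by field_simp; norm_num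
    have e2 : 1 + -1 / (t + 1 : ℝ) = t / (t + 1 : ℕ) := by push_cast; field_simp; ring
    rw [e1, e2] at h
    have h2 := pow_le_pow_left₀ (by norm_num) h 2
    rw [← Real.rpow_natCast (_ ^ _) 2, ← Real.rpow_mul (by positivity)] at h2
    have e3 : ((t : ℝ) + 1) / 2 * (2 : ℕ) = (t + 1 : ℕ) := by push_cast; ring
    rw [e3, Real.rpow_natCast] at h2
    have e4 : (1 / 2 : ℝ) ^ 2 = 1 / 4 := by norm_num
    rw [e4] at h2
    linarith
  | succ n hn ih => exact (binomialCdf_succ_div_le ht0 hn).trans ih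

theorem binomialCdf_lt {n t : ℕ} {x : ℝ} (hn : 0 < n) (ht0 : 0 < t) (hx : t / (n : ℝ) < x) (hx1 : x ≤ 1) :
    binomialCdf n t x < 3 / 4 := by
  have ht : (0 : ℝ) < t := by exact_mod_cast ht0
  have hn' : (0 : ℝ) < n := by exact_mod_cast hn
  have htn : t < n := by
    have := hx.trans_le hx1
    rw [div_lt_one hn'] at this
    exact_mod_cast this
  exact (strictAntiOn_binomialCdf htn ⟨by positivity, (hx.trans_le hx1).le⟩
    ⟨(by positivity : (0 : ℝ) ≤ t / n).trans hx.le, hx1⟩ hx).trans_le (binomialCdf_div_le ht0 htn)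

/-! ### Sampling without replacement and random permutations -/

section Hypergeometric

variable {α : Type*} [Fintype α] [DecidableEq α]

theorem card_filter_powersetCard_inter_eq (G : Finset α) {m j : ℕ} (hj : j ≤ m) :
    ((Finset.powersetCard m (Finset.univ : Finset α)).filter fun J => (J ∩ G).card = j).card =
      G.card.choose j * (Fintype.card α - G.card).choose (m - j) := by
  rw [← Finset.card_compl, ← Finset.card_powersetCard, ← Finset.card_powersetCard,
    ← Finset.card_product]
  refine Finset.card_nbij' (fun J => (J ∩ G, J ∩ Gᶜ)) (fun A => A.1 ∪ A.2) ?_ ?_ ?_ ?_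
  · intro J hJ
    simp only [Finset.coe_filter, Finset.mem_powersetCard, Set.mem_ofPred_eq] at hJ
    have h := Finset.card_inter_add_card_sdiff J G
    rw [Finset.sdiff_eq_inter_compl] at h
    simp only [Finset.coe_product, Set.mem_prod, Finset.mem_coe, Finset.mem_powersetCard]
    exact ⟨⟨Finset.inter_subset_right, hJ.2⟩, Finset.inter_subset_right, by omega⟩
  · rintro ⟨A, B⟩ hAB
    simp only [Finset.coe_product, Set.mem_prod, Finset.mem_coe, Finset.mem_powersetCard] at hAB
    obtain ⟨⟨hA, hA'⟩, hB, hB'⟩ := hAB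
    have hd : Disjoint B G := (Finset.subset_compl_iff_disjoint_right).1 hB
    have hd' : Disjoint A B := Finset.disjoint_of_subset_left hA hd.symm
    simp only [Finset.coe_filter, Finset.mem_powersetCard, Set.mem_ofPred_eq]
    refine ⟨⟨Finset.subset_univ _, ?_⟩, ?_⟩
    · rw [Finset.card_union_of_disjoint hd']; omega
    · rw [Finset.union_inter_distrib_right, Finset.inter_eq_left.2 hA,
        Finset.disjoint_iff_inter_eq_empty.1 hd, Finset.union_empty, hA']
  · intro J _
    simp only
    rw [← Finset.inter_union_distrib_left, Finset.union_compl, Finset.inter_univ]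
  · rintro ⟨A, B⟩ hAB
    simp only [Finset.coe_product, Set.mem_prod, Finset.mem_coe, Finset.mem_powersetCard] at hAB
    obtain ⟨⟨hA, -⟩, hB, -⟩ := hAB
    have hd : Disjoint B G := (Finset.subset_compl_iff_disjoint_right).1 hB
    have hd' : Disjoint A Gᶜ := Finset.disjoint_of_subset_left hA disjoint_compl_right
    simp only [Finset.union_inter_distrib_right, Finset.inter_eq_left.2 hA,
      Finset.inter_eq_left.2 hB, Finset.disjoint_iff_inter_eq_empty.1 hd,
      Finset.disjoint_iff_inter_eq_empty.1 hd', Finset.union_empty, Finset.empty_union]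

/-- The hypergeometric tail counts the samples of size `m` that meet `G` in at most `k` points. -/
theorem hypTail_mul_choose (G : Finset α) {k m : ℕ} (hkm : k ≤ m) (hm : m ≤ Fintype.card α) :
    hypTail k m G.card (Fintype.card α) * (Fintype.card α).choose m =
      ((Finset.powersetCard m (Finset.univ : Finset α)).filter
        fun J => (J ∩ G).card ≤ k).card := by
  have hC : ((Fintype.card α).choose m : ℝ) ≠ 0 := by exact_mod_cast (Nat.choose_pos hm).ne'
  unfold hypTail
  rw [← Finset.sum_div, div_mul_cancel₀ _ hC, Finset.card_eq_sum_card_fiberwise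
    (f := fun J => (J ∩ G).card) (t := Finset.range (k + 1))]
  · push_cast
    refine Finset.sum_congr rfl fun j hj => ?_
    have hjk : j ≤ k := by simpa [Nat.lt_succ_iff] using hj
    rw [Finset.filter_filter, ← Nat.cast_mul, ← card_filter_powersetCard_inter_eq G
      (hjk.trans hkm)]
    congr 2
    ext J
    simp only [Finset.mem_filter]
    constructor
    · rintro ⟨h1, h2⟩; exact ⟨h1, h2 ▸ hjk, h2⟩
    · rintro ⟨h1, -, h2⟩; exact ⟨h1, h2⟩
  · intro J hJ
    simpa [Nat.lt_succ_iff] using (Finset.mem_filter.1 hJ).2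

/-- The image of `I` under a uniform permutation is uniform among sets of its size: left translation
matches any two fibres. -/
theorem card_filter_map_perm_mul (I : Finset α) (P : Finset α → Prop) [DecidablePred P] :
    (Finset.univ.filter fun σ : Equiv.Perm α => P (I.map σ.toEmbedding)).card *
        (Fintype.card α).choose I.card =
      ((Finset.powersetCard I.card (Finset.univ : Finset α)).filter P).card *
        (Fintype.card α).factorial := by
  classical
  set c := (Finset.univ.filter fun σ : Equiv.Perm α => I.map σ.toEmbedding = I).card with hc
  have hfib : ∀ J ∈ Finset.powersetCard I.card (Finset.univ : Finset α),
      (Finset.univ.filter fun σ : Equiv.Perm α => I.map σ.toEmbedding = J).card = c := by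
    intro J hJ
    obtain ⟨τ, hτ⟩ : ∃ τ : Equiv.Perm α, I.map τ.toEmbedding = J := by
      have e : {x // x ∈ I} ≃ {x // x ∈ J} :=
        Finset.equivOfCardEq (Finset.mem_powersetCard.1 hJ).2.symm
      refine ⟨e.extendSubtype, ?_⟩
      refine Finset.eq_of_subset_of_card_le ?_ ?_
      · intro x hx
        obtain ⟨y, hy, rfl⟩ := Finset.mem_map.1 hx
        exact e.extendSubtype_mem y hy
      · rw [Finset.card_map, (Finset.mem_powersetCard.1 hJ).2]
    subst hτ
    rw [hc]
    refine Finset.card_nbij' (fun σ => τ⁻¹ * σ) (fun σ => τ * σ) ?_ ?_ ?_ ?_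
    · intro σ hσ
      simp only [Finset.coe_filter, Finset.mem_univ, true_and, Set.mem_ofPred_eq] at hσ ⊢
      have h := congrArg (Finset.map (τ⁻¹ : Equiv.Perm α).toEmbedding) hσ
      rw [Finset.map_map, Finset.map_map] at h
      refine Eq.trans h ?_
      ext x
      simp
    · intro σ hσ
      simp only [Finset.coe_filter, Finset.mem_univ, true_and, Set.mem_ofPred_eq] at hσ ⊢
      conv_rhs => rw [← hσ, Finset.map_map]
      rfl
    · intro σ _; simp
    · intro σ _; simp
  have hsum : ∀ (Q : Finset α → Prop) [DecidablePred Q],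
      (Finset.univ.filter fun σ : Equiv.Perm α => Q (I.map σ.toEmbedding)).card =
        ((Finset.powersetCard I.card (Finset.univ : Finset α)).filter Q).card * c := by
    intro Q _
    rw [Finset.card_eq_sum_card_fiberwise (f := fun σ : Equiv.Perm α => I.map σ.toEmbedding)
      (t := (Finset.powersetCard I.card (Finset.univ : Finset α)).filter Q)]
    · rw [Finset.sum_const_nat]
      intro J hJ
      rw [Finset.mem_filter] at hJ
      rw [← hfib J hJ.1, Finset.filter_filter]
      congr 1
      ext σ
      simp only [Finset.mem_filter, Finset.mem_univ, true_and, and_iff_right_iff_imp]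
      rintro rfl
      exact hJ.2
    · intro σ hσ
      simp only [Finset.coe_filter, Finset.mem_univ, true_and, Set.mem_ofPred_eq] at hσ
      simp [Finset.mem_powersetCard, hσ]
  -- The trivial predicate determines the common fibre size `c`.
  have htot := hsum fun _ => True
  simp only [Finset.filter_true, Finset.card_univ, Fintype.card_perm,
    Finset.card_powersetCard] at htot
  rw [hsum P, htot]
  ring

theorem hypTail_anti {k m K K' M : ℕ} (hK : K ≤ K') (hK' : K' ≤ M) (hkm : k ≤ m) (hm : m ≤ M) :
    hypTail k m K' M ≤ hypTail k m K M := by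
  obtain ⟨G', -, hG'⟩ := Finset.exists_subset_card_eq (s := (Finset.univ : Finset (Fin M)))
    (n := K') (by simpa using hK')
  obtain ⟨G, hGG, hG⟩ := Finset.exists_subset_card_eq (s := G') (n := K) (by omega)
  have hC : (0 : ℝ) < (Fintype.card (Fin M)).choose m := by
    exact_mod_cast Nat.choose_pos (by simpa using hm)
  have h1 := hypTail_mul_choose G hkm (by simpa using hm)
  have h2 := hypTail_mul_choose G' hkm (by simpa using hm)
  rw [hG, Fintype.card_fin] at h1
  rw [hG', Fintype.card_fin] at h2
  rw [Fintype.card_fin] at hC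
  rw [← mul_le_mul_iff_left₀ hC, h1, h2, Nat.cast_le]
  refine Finset.card_le_card (Finset.monotone_filter_right _ fun J _ hJ => ?_)
  exact (Finset.card_le_card (Finset.inter_subset_inter_left hGG)).trans hJ

/-- Adding `d` points to the marked set raises its intersection with any sample by at most `d`. -/
theorem hypTail_le_add {k m K M : ℕ} (d : ℕ) (hK : K + d ≤ M) (hkm : k + d ≤ m) (hm : m ≤ M) :
    hypTail k m K M ≤ hypTail (k + d) m (K + d) M := by
  obtain ⟨G', -, hG'⟩ := Finset.exists_subset_card_eq (s := (Finset.univ : Finset (Fin M)))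
    (n := K + d) (by simpa using hK)
  obtain ⟨G, hGG, hG⟩ := Finset.exists_subset_card_eq (s := G') (n := K) (by omega)
  have hC : (0 : ℝ) < (Fintype.card (Fin M)).choose m := by
    exact_mod_cast Nat.choose_pos (by simpa using hm)
  have h1 := hypTail_mul_choose G (k := k) (m := m) (by omega) (by simpa using hm)
  have h2 := hypTail_mul_choose G' hkm (by simpa using hm)
  rw [hG, Fintype.card_fin] at h1
  rw [hG', Fintype.card_fin] at h2
  rw [Fintype.card_fin] at hC
  rw [← mul_le_mul_iff_left₀ hC, h1, h2, Nat.cast_le]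
  refine Finset.card_le_card (Finset.monotone_filter_right _ fun J _ hJ => ?_)
  have h3 : J ∩ G' ⊆ (J ∩ G) ∪ (G' \ G) := by
    intro x hx
    simp only [Finset.mem_inter, Finset.mem_union, Finset.mem_sdiff] at hx ⊢
    tauto
  have h4 := (Finset.card_le_card h3).trans (Finset.card_union_le _ _)
  rw [Finset.card_sdiff_of_subset hGG] at h4
  omega

theorem hypTailInv_spec {k m M : ℕ} {δ : ℝ} (hkm : k < m) (hδ : 0 ≤ δ) :
    hypTailInv k m δ M ≤ M ∧ hypTail k m (hypTailInv k m δ M) M ≤ δ := by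
  -- If all `M` elements are successes, fewer than `m` successes in `m` draws is impossible, so `M`
  -- belongs to the set.
  refine Nat.sInf_mem (s := {K : ℕ | K ≤ M ∧ hypTail k m K M ≤ δ}) ⟨M, le_rfl, ?_⟩
  refine le_of_eq_of_le ?_ hδ
  refine Finset.sum_eq_zero fun j hj => ?_
  rw [Finset.mem_range] at hj
  rw [Nat.choose_eq_zero_of_lt (show M - M < m - j by omega)]
  simp

/-- A random sample of size `m` contains, with probability at most `δ`, so few points of a fixed
set `G` that the hypergeometric bound is violated. -/
theorem card_filter_hypTailInv_le (G : Finset α) {m : ℕ} (hm : m ≤ Fintype.card α) {δ : ℝ}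
    (hδ : 0 ≤ δ) :
    (((Finset.powersetCard m (Finset.univ : Finset α)).filter fun J =>
      ∃ k < m, (J ∩ G).card ≤ k ∧
        hypTailInv k m δ (Fintype.card α) ≤ (G \ J).card + k).card : ℝ) ≤
      δ * (Fintype.card α).choose m := by
  set B := (Finset.powersetCard m (Finset.univ : Finset α)).filter fun J =>
      ∃ k < m, (J ∩ G).card ≤ k ∧
        hypTailInv k m δ (Fintype.card α) ≤ (G \ J).card + k with hB
  rcases B.eq_empty_or_nonempty with h0 | h0
  · rw [h0, Finset.card_empty, Nat.cast_zero]
    positivity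
  -- The witness `k` depends on `J`. Taking the bad `J₀` with the largest intersection `j` puts
  -- every bad `J` in the single tail event of meeting `G` in at most `j` points, so no union bound
  -- over `k` is needed.
  obtain ⟨J₀, hJ₀, hmax⟩ := B.exists_max_image (fun J => (J ∩ G).card) h0
  obtain ⟨hJm, k, hkm, hJk, hk⟩ := Finset.mem_filter.1 hJ₀
  have hJm := (Finset.mem_powersetCard.1 hJm).2
  set j := (J₀ ∩ G).card with hj
  have hJG := Finset.card_inter_add_card_sdiff J₀ G
  have hGJ := Finset.card_inter_add_card_sdiff G J₀
  rw [Finset.inter_comm] at hGJ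
  have hout : (J₀ \ G).card + G.card ≤ Fintype.card α := by
    rw [← Finset.card_union_of_disjoint Finset.sdiff_disjoint]
    exact Finset.card_le_univ _
  have hspec := hypTailInv_spec (M := Fintype.card α) hkm hδ
  have htail : hypTail j m G.card (Fintype.card α) ≤ δ := by
    -- Raise both `j` and the size of `G` by `k - j`; badness of `J₀` says the enlarged size is at
    -- least the inverse tail at `k`.
    refine (hypTail_le_add (k - j) (by omega) (by omega) hm).trans ?_
    rw [Nat.add_sub_cancel' hJk]
    exact (hypTail_anti (by omega) (by omega) hkm.le hm).trans hspec.2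
  refine le_trans ?_ (mul_le_mul_of_nonneg_right htail (Nat.cast_nonneg _))
  rw [hypTail_mul_choose G (by omega) hm, Nat.cast_le]
  refine Finset.card_le_card fun J hJ => ?_
  exact Finset.mem_filter.2 ⟨(Finset.mem_filter.1 hJ).1, hmax J hJ⟩

theorem card_perm_hypTailInv_le (I G : Finset α) {δ : ℝ} (hδ : 0 ≤ δ) :
    ((Finset.univ.filter fun σ : Equiv.Perm α =>
      ∃ k < I.card, (I.map σ.toEmbedding ∩ G).card ≤ k ∧
        hypTailInv k I.card δ (Fintype.card α) ≤
          (G \ I.map σ.toEmbedding).card + k).card : ℝ) ≤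
      δ * (Fintype.card α).factorial := by
  have hI : I.card ≤ Fintype.card α := Finset.card_le_univ I
  have hC : (0 : ℝ) < (Fintype.card α).choose I.card := by exact_mod_cast Nat.choose_pos hI
  have h1 := card_filter_map_perm_mul I fun J => ∃ k < I.card, (J ∩ G).card ≤ k ∧
        hypTailInv k I.card δ (Fintype.card α) ≤ (G \ J).card + k
  have h2 := card_filter_hypTailInv_le G hI hδ
  rw [← mul_le_mul_iff_left₀ hC]
  have h3 := congrArg (Nat.cast (R := ℝ)) h1
  push_cast at h3
  rw [h3]
  calc _ ≤ δ * (Fintype.card α).choose I.card * (Fintype.card α).factorial := by gcongr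
    _ = _ := by ring

end Hypergeometric

/-! ### Lipschitz margins and finite covers -/

section Covering

variable {X : Type*} {n : ℕ}

/-- Convexity of `x ^ p` on two coordinates. Only two matter, so the Lipschitz constant of the
margin does not depend on `n`. -/
theorem abs_add_abs_le_two_rpow_mul {p : ℝ} (hp : 1 ≤ p) {v : Fin n → ℝ} {i j : Fin n}
    (hij : i ≠ j) :
    |v i| + |v j| ≤ 2 ^ (1 - 1 / p) * (∑ l, |v l| ^ p) ^ (1 / p) := by
  have hp0 : 0 < p := by linarith
  have h1 : (|v i| + |v j|) ^ p ≤ 2 ^ (p - 1) * (|v i| ^ p + |v j| ^ p) := by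
    have := NNReal.rpow_add_le_mul_rpow_add_rpow (Real.nnabs (v i)) (Real.nnabs (v j)) hp
    exact_mod_cast this
  have h2 : |v i| ^ p + |v j| ^ p ≤ ∑ l, |v l| ^ p := by
    rw [← Finset.sum_pair (f := fun l => |v l| ^ p) hij]
    exact Finset.sum_le_sum_of_subset_of_nonneg (Finset.subset_univ _)
      fun _ _ _ => by positivity
  have h3 := h1.trans (mul_le_mul_of_nonneg_left h2 (by positivity))
  have h4 := Real.rpow_le_rpow (by positivity) h3 (show 0 ≤ 1 / p by positivity)
  rw [← Real.rpow_mul (by positivity), mul_one_div_cancel hp0.ne', Real.rpow_one,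
    Real.mul_rpow (by positivity) (Finset.sum_nonneg fun _ _ => by positivity),
    ← Real.rpow_mul (by positivity)] at h4
  have e : (p - 1) * (1 / p) = 1 - 1 / p := by field_simp
  rwa [e] at h4

theorem abs_le_two_rpow_mul {p : ℝ} (hp : 1 ≤ p) (v : Fin n → ℝ) (i : Fin n) :
    |v i| ≤ 2 ^ (1 - 1 / p) * (∑ l, |v l| ^ p) ^ (1 / p) := by
  have hp0 : 0 < p := by linarith
  have h2 : |v i| ^ p ≤ ∑ l, |v l| ^ p :=
    Finset.single_le_sum (f := fun l => |v l| ^ p) (fun _ _ => by positivity)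
      (Finset.mem_univ i)
  have h4 := Real.rpow_le_rpow (by positivity) h2 (show 0 ≤ 1 / p by positivity)
  rw [← Real.rpow_mul (by positivity), mul_one_div_cancel hp0.ne', Real.rpow_one] at h4
  refine h4.trans (le_mul_of_one_le_left (by positivity) ?_)
  refine Real.one_le_rpow (by norm_num) ?_
  rw [sub_nonneg, div_le_one hp0]
  exact hp

theorem margin_le_add {p : ℝ} (hp : 1 ≤ p) (v w : Fin n → ℝ) (y : Fin n) :
    margin v y ≤ margin w y + 2 ^ (1 - 1 / p) * (∑ l, |v l - w l| ^ p) ^ (1 / p) := by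
  unfold margin
  rcases isEmpty_or_nonempty {j : Fin n // j ≠ y} with h | h
  -- With a single label the supremum is over the empty type and equals 0, so the margin is the
  -- score itself.
  · rw [Real.iSup_of_isEmpty, Real.iSup_of_isEmpty]
    have := (le_abs_self _).trans (abs_le_two_rpow_mul hp (fun l => v l - w l) y)
    linarith
  -- With `j` the best competitor for `w`, the margins differ by at most the changes in coordinates
  -- `y` and `j`.
  · obtain ⟨j, hj⟩ := exists_eq_ciSup_of_finite (f := fun j : {j : Fin n // j ≠ y} => w j)
    rw [← hj]
    have h1 : v j ≤ ⨆ j : {j : Fin n // j ≠ y}, v j :=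
      le_ciSup (f := fun j : {j : Fin n // j ≠ y} => v j) (Set.finite_range _).bddAbove j
    have h2 := abs_add_abs_le_two_rpow_mul hp (v := fun l => v l - w l) j.2
    have h3 := neg_abs_le (v j - w j)
    have h4 := le_abs_self (v y - w y)
    linarith

theorem le_mixedDist {N : ℕ} (p : ℝ) (A B : Fin N → Fin n → ℝ) (i : Fin N) :
    (∑ j, |A i j - B i j| ^ p) ^ (1 / p) ≤ mixedDist p A B :=
  le_ciSup (f := fun i => (∑ j, |A i j - B i j| ^ p) ^ (1 / p)) (Set.finite_range _).bddAbove i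

theorem margin_lt_add_half {N : ℕ} {p γ : ℝ} (hp : 1 ≤ p) {A B : Fin N → Fin n → ℝ}
    (h : mixedDist p A B < γ / 2 ^ (2 - 1 / p)) (i : Fin N) (y : Fin n) :
    margin (A i) y < margin (B i) y + γ / 2 := by
  refine (margin_le_add hp (A i) (B i) y).trans_lt ?_
  have h1 := (le_mixedDist p A B i).trans_lt h
  have e : (2 : ℝ) ^ (2 - 1 / p) = 2 ^ (1 - 1 / p) * 2 := by
    rw [show 2 - 1 / p = (1 - 1 / p) + 1 by ring, Real.rpow_add_one (by norm_num)]
  have h2 : (0 : ℝ) < 2 ^ (1 - 1 / p) := by positivity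
  rw [e, lt_div_iff₀ (by positivity)] at h1
  linarith

theorem mixedDist_comm {N : ℕ} (p : ℝ) (A B : Fin N → Fin n → ℝ) :
    mixedDist p A B = mixedDist p B A := by
  simp only [mixedDist, abs_sub_comm]

theorem margin_nonpos_of_ne {v : Fin n → ℝ} {i y : Fin n} (hi : ∀ j, v j ≤ v i) (hiy : i ≠ y) :
    margin v y ≤ 0 := by
  have h1 : v i ≤ ⨆ j : {j : Fin n // j ≠ y}, v j :=
    le_ciSup (f := fun j : {j : Fin n // j ≠ y} => v j) (Set.finite_range _).bddAbove ⟨i, hiy⟩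
  have := hi y
  unfold margin
  linarith

theorem exists_cover_encard_eq {N : ℕ} {p c : ℝ} {W : Set (Fin N → Fin n → ℝ)}
    (h : coveringNumber p c W ≠ ⊤) :
    ∃ W', IsCover p c W' W ∧ W'.encard = coveringNumber p c W := by
  have hne : Nonempty {W' // IsCover p c W' W} := by
    by_contra hc
    rw [not_nonempty_iff, isEmpty_subtype] at hc
    exact h (by simp [coveringNumber, hc])
  obtain ⟨W', hW'⟩ := ENat.exists_eq_iInf fun W' : {W' // IsCover p c W' W} => W'.1.encard
  exact ⟨W'.1, W'.2, by rw [hW', coveringNumber, iInf_subtype]⟩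

theorem mixedDist_lt_of_forall_abs_le {N : ℕ} {p c η : ℝ} (hp : 1 ≤ p) (hη : 0 ≤ η)
    {A B : Fin N → Fin n → ℝ} (h : ∀ i j, |A i j - B i j| ≤ η)
    (hc : (n * η ^ p) ^ (1 / p) < c) : mixedDist p A B < c := by
  refine lt_of_le_of_lt ?_ hc
  refine Real.iSup_le (fun i => ?_) (by positivity)
  refine Real.rpow_le_rpow (Finset.sum_nonneg fun _ _ => by positivity) ?_ (by positivity)
  calc ∑ j, |A i j - B i j| ^ p ≤ ∑ _j : Fin n, η ^ p :=
        Finset.sum_le_sum fun j _ => Real.rpow_le_rpow (abs_nonneg _) (h i j) (by linarith)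
    _ = n * η ^ p := by simp

theorem exists_pos_rpow_lt (n : ℕ) {p c : ℝ} (hp : 1 ≤ p) (hc : 0 < c) :
    ∃ q : ℕ, 0 < q ∧ (n * (1 / q : ℝ) ^ p) ^ (1 / p) < c := by
  have hp0 : 0 < p := by linarith
  have h : Filter.Tendsto (fun q : ℕ => (n * (1 / q : ℝ) ^ p) ^ (1 / p)) Filter.atTop
      (nhds ((n * (0 : ℝ) ^ p) ^ (1 / p))) := by
    refine Filter.Tendsto.rpow_const ?_ (Or.inr (by positivity))
    refine Filter.Tendsto.const_mul _ ?_
    exact tendsto_one_div_atTop_nhds_zero_nat.rpow_const (Or.inr hp0.le)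
  rw [Real.zero_rpow hp0.ne', mul_zero, Real.zero_rpow (by positivity)] at h
  obtain ⟨q, hq, hq0⟩ := ((h.eventually_lt_const hc).and (Filter.eventually_gt_atTop 0)).exists
  exact ⟨q, hq0, hq⟩

/-- Classes of functions with values in the unit cube have finite uniform covering numbers. -/
theorem uniformCoveringNumber_ne_top {F : Set (X → Fin n → ℝ)}
    (hF : ∀ f ∈ F, ∀ x i, f x i ∈ Set.Icc (0 : ℝ) 1) {p c : ℝ} (hp : 1 ≤ p) (hc : 0 < c)
    (N : ℕ) : uniformCoveringNumber p F c N ≠ ⊤ := by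
  obtain ⟨q, hq0, hq⟩ := exists_pos_rpow_lt n hp hc
  have hq0' : (0 : ℝ) < q := by exact_mod_cast hq0
  let K := Fin N → Fin n → Fin (q + 1)
  suffices h : uniformCoveringNumber p F c N ≤ Fintype.card K from
    ne_top_of_le_ne_top (ENat.natCast_ne_top _) h
  refine iSup_le fun x => ?_
  set W := restriction F x with hW
  have hW01 : ∀ w ∈ W, ∀ i j, w i j ∈ Set.Icc (0 : ℝ) 1 := by
    rintro _ ⟨f, hf, rfl⟩ i j
    exact hF f hf (x i) j
  -- Round every coordinate down to a grid of mesh `1 / q`; points of one cell are close.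
  let cell : W → K := fun w i j => ⟨⌊w.1 i j * q⌋₊, by
    rw [Nat.lt_succ_iff]
    refine Nat.floor_le_of_le ?_
    have := (hW01 w w.2 i j).2
    nlinarith⟩
  have hcell : ∀ w w' : W, cell w = cell w' → mixedDist p w.1 w'.1 < c := by
    intro w w' h
    refine mixedDist_lt_of_forall_abs_le hp (by positivity) (fun i j => ?_) hq
    have h1 : ⌊w.1 i j * q⌋₊ = ⌊w'.1 i j * q⌋₊ :=
      congrArg Fin.val (congrFun (congrFun h i) j)
    have h2 := Nat.lt_floor_add_one (w.1 i j * q)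
    have h3 := Nat.lt_floor_add_one (w'.1 i j * q)
    have h4 := Nat.floor_le (mul_nonneg (hW01 w w.2 i j).1 hq0'.le)
    have h5 := Nat.floor_le (mul_nonneg (hW01 w' w'.2 i j).1 hq0'.le)
    rw [h1] at h2 h4
    rw [abs_le, le_div_iff₀ hq0', neg_le, neg_sub, le_div_iff₀ hq0']
    constructor <;> linarith
  -- Covers must be proper, so each occupied cell is represented by a point of `W`, not by a grid
  -- point.
  obtain ⟨s, hs⟩ : ∃ s : Set.range cell → W, ∀ k, cell (s k) = k :=
    ⟨fun k => k.2.choose, fun k => k.2.choose_spec⟩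
  let W' : Set (Fin N → Fin n → ℝ) := Set.range fun k => (s k).1
  have hcov : IsCover p c W' W := by
    refine ⟨?_, fun w hw => ?_⟩
    · rintro _ ⟨k, rfl⟩
      exact (s k).2
    · refine ⟨_, ⟨⟨cell ⟨w, hw⟩, ⟨w, hw⟩, rfl⟩, rfl⟩, ?_⟩
      exact hcell ⟨w, hw⟩ _ (hs ⟨cell ⟨w, hw⟩, ⟨w, hw⟩, rfl⟩).symm
  refine (iInf₂_le W' hcov).trans ?_
  calc W'.encard ≤ (Set.univ : Set (Set.range cell)).encard := by
        rw [show W' = (fun k => (s k).1) '' Set.univ from Set.image_univ.symm]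
        exact Set.encard_image_le _ _
    _ = (Set.range cell).encard := by rw [Set.encard_univ]; rfl
    _ ≤ (Set.univ : Set K).encard := Set.encard_le_encard (Set.subset_univ _)
    _ = Fintype.card K := by rw [Set.encard_univ, ENat.card_eq_coe_fintype_card]

end Covering

/-! ### Product measures: concatenation, permutation, counting -/

section ProductMeasure

variable {Z : Type*} [MeasurableSpace Z]

theorem measurePreserving_append (D : Measure Z) [IsProbabilityMeasure D] (m m' : ℕ) :
    MeasurePreserving (fun z : (Fin m → Z) × (Fin m' → Z) => Fin.append z.1 z.2)
      ((Measure.pi fun _ => D).prod (Measure.pi fun _ => D)) (Measure.pi fun _ => D) := by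
  have hmeas : Measurable fun z : (Fin m → Z) × (Fin m' → Z) => Fin.append z.1 z.2 := by
    refine measurable_pi_lambda _ fun i => ?_
    refine Fin.addCases (fun i => ?_) (fun i => ?_) i
    · simp only [Fin.append_left]; fun_prop
    · simp only [Fin.append_right]; fun_prop
  refine ⟨hmeas, (Measure.pi_eq fun s hs => ?_).symm⟩
  rw [Measure.map_apply hmeas (MeasurableSet.univ_pi hs), Fin.prod_univ_add,
    ← Measure.pi_pi (fun _ : Fin m => D), ← Measure.pi_pi (fun _ : Fin m' => D),
    ← Measure.prod_prod]
  congr 1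
  ext z
  simp only [Set.mem_preimage, Set.mem_univ_pi, Set.mem_prod]
  constructor
  · exact fun H => ⟨fun i => by simpa using H (Fin.castAdd m' i),
      fun i => by simpa using H (Fin.natAdd m i)⟩
  · rintro ⟨H1, H2⟩ i
    refine Fin.addCases (fun i => ?_) (fun i => ?_) i
    · simpa using H1 i
    · simpa using H2 i

theorem measurePreserving_comp_perm {ι : Type*} [Fintype ι] (D : Measure Z)
    [IsProbabilityMeasure D] (σ : Equiv.Perm ι) :
    MeasurePreserving (fun T : ι → Z => T ∘ σ)
      (Measure.pi fun _ => D) (Measure.pi fun _ => D) := by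
  have hmeas : Measurable fun T : ι → Z => T ∘ σ :=
    measurable_pi_lambda _ fun i => measurable_pi_apply (σ i)
  refine ⟨hmeas, (Measure.pi_eq fun s hs => ?_).symm⟩
  rw [Measure.map_apply hmeas (MeasurableSet.univ_pi hs)]
  have e : (fun T : ι → Z => T ∘ σ) ⁻¹' Set.univ.pi s = Set.univ.pi fun i => s (σ.symm i) := by
    ext T
    simp only [Set.mem_preimage, Set.mem_univ_pi, Function.comp_apply]
    exact ⟨fun H i => by simpa using H (σ.symm i), fun H i => by simpa using H (σ i)⟩
  rw [e, Measure.pi_pi]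
  exact Equiv.prod_comp σ.symm fun i => D (s i)

open scoped Classical in
/-- The number of indices at which an i.i.d. sample hits `A` has a binomial distribution. -/
theorem measureReal_card_le_eq_binomialCdf (D : Measure Z) [IsProbabilityMeasure D]
    {A : Set Z} (hA : MeasurableSet A) (N t : ℕ) :
    (Measure.pi fun _ : Fin N => D).real
      {S | (Finset.univ.filter fun i => S i ∈ A).card ≤ t} = binomialCdf N t (D.real A) := by
  -- Prescribing the exact set of hits gives a box, whose measure is a product.
  have hE (E : Finset (Fin N)) : {S : Fin N → Z | (Finset.univ.filter fun i => S i ∈ A) = E} =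
      Set.univ.pi fun i => if i ∈ E then A else Aᶜ := by
    ext S
    simp only [Set.mem_ofPred_eq, Set.mem_univ_pi, Finset.ext_iff, Finset.mem_filter,
      Finset.mem_univ, true_and]
    refine forall_congr' fun i => ?_
    by_cases hi : i ∈ E <;> simp [hi]
  have hEm (E : Finset (Fin N)) :
      MeasurableSet {S : Fin N → Z | (Finset.univ.filter fun i => S i ∈ A) = E} := by
    rw [hE]
    refine MeasurableSet.univ_pi fun i => ?_
    split_ifs
    exacts [hA, hA.compl]
  have hEp (E : Finset (Fin N)) : (Measure.pi fun _ : Fin N => D).real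
      {S | (Finset.univ.filter fun i => S i ∈ A) = E} =
      D.real A ^ E.card * (1 - D.real A) ^ (N - E.card) := by
    rw [hE, Measure.real, Measure.pi_pi, ENNReal.toReal_prod]
    have e : ∀ i, (D (if i ∈ E then A else Aᶜ)).toReal =
        if i ∈ E then D.real A else 1 - D.real A := by
      intro i
      split_ifs
      · rfl
      · exact probReal_compl_eq_one_sub hA
    simp only [e]
    rw [Finset.prod_ite, Finset.prod_const, Finset.prod_const, Finset.filter_mem_eq_inter,
      Finset.univ_inter, ← Finset.compl_filter, Finset.filter_mem_eq_inter, Finset.univ_inter,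
      Finset.card_compl, Fintype.card_fin]
  have hU : {S : Fin N → Z | (Finset.univ.filter fun i => S i ∈ A).card ≤ t} =
      ⋃ E ∈ (Finset.univ.filter fun E : Finset (Fin N) => E.card ≤ t),
        {S | (Finset.univ.filter fun i => S i ∈ A) = E} := by
    ext S
    simp
  rw [hU, measureReal_biUnion_finset]
  · simp only [hEp]
    rw [binomialCdf, ← Finset.sum_fiberwise_of_maps_to (g := Finset.card)
      (t := Finset.range (t + 1))]
    · refine Finset.sum_congr rfl fun j hj => ?_
      rw [Finset.sum_congr rfl (g := fun _ => D.real A ^ j * (1 - D.real A) ^ (N - j))]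
      · rw [Finset.sum_const, nsmul_eq_mul, ← mul_assoc]
        congr 3
        conv_rhs => rw [← Fintype.card_fin N, ← Finset.card_univ, ← Finset.card_powersetCard]
        congr 1
        ext E
        simp only [Finset.mem_filter, Finset.mem_univ, true_and, Finset.mem_powersetCard,
          Finset.subset_univ]
        rw [Finset.mem_range] at hj
        omega
      · intro E hE
        rw [(Finset.mem_filter.1 hE).2]
    · intro E hE
      rw [Finset.mem_filter] at hE
      exact Finset.mem_range.2 (by omega)
  · intro E _ E' _ hne
    refine Set.disjoint_left.2 fun S h1 h2 => hne ?_
    exact h1.symm.trans h2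
  · exact fun E _ => hEm E

end ProductMeasure

/-! ### Ghost samples and the permutation argument -/

section Symmetrization

open scoped Classical

variable {X : Type*} {n : ℕ}

/-- The indices at which the classifier `g` errs on the sample `T`. -/
noncomputable def errorIndices {N : ℕ} (g : X → Fin n) (T : Fin N → X × Fin n) :
    Finset (Fin N) :=
  Finset.univ.filter fun i => g (T i).1 ≠ (T i).2

/-- The indices at which the scores `f` have margin less than `γ` on the sample `T`. -/
noncomputable def marginIndices {N : ℕ} (γ : ℝ) (f : X → Fin n → ℝ) (T : Fin N → X × Fin n) :
    Finset (Fin N) :=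
  Finset.univ.filter fun i => margin (f (T i).1) (T i).2 < γ

/-- The first `m` of `m + m'` indices. -/
def firstIndices (m m' : ℕ) : Finset (Fin (m + m')) :=
  Finset.univ.map (Fin.castAddEmb m')

theorem card_firstIndices (m m' : ℕ) : (firstIndices m m').card = m := by
  simp [firstIndices]

/-- The margin indices `G` have fewer than `m` elements in `I` and the error indices `E` have so
many outside `I` that the hypergeometric bound is violated. -/
def IsBadSplit {M : ℕ} (δ : ℝ) (I E G : Finset (Fin M)) : Prop :=
  ∃ k < I.card, (I ∩ G).card ≤ k ∧ hypTailInv k I.card δ M ≤ (E \ I).card + k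

/-- Shrinking `G` and enlarging `E` only help, since `k` is merely an upper bound for the
intersection. This reduces two sets depending on `f` to one depending on the cover. -/
theorem IsBadSplit.mono {M : ℕ} {δ : ℝ} {I E G H : Finset (Fin M)} (h : IsBadSplit δ I E G)
    (hEH : E ⊆ H) (hHG : H ⊆ G) : IsBadSplit δ I H H := by
  obtain ⟨k, hk, h1, h2⟩ := h
  refine ⟨k, hk, (Finset.card_le_card (Finset.inter_subset_inter_left hHG)).trans h1, h2.trans ?_⟩
  exact Nat.add_le_add_right (Finset.card_le_card (Finset.sdiff_subset_sdiff hEH le_rfl)) k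

theorem IsBadSplit.map {M : ℕ} {δ : ℝ} {I E G : Finset (Fin M)} (σ : Equiv.Perm (Fin M)) :
    IsBadSplit δ (I.map σ.toEmbedding) (E.map σ.toEmbedding) (G.map σ.toEmbedding) ↔
      IsBadSplit δ I E G := by
  have h : E.map σ.toEmbedding \ I.map σ.toEmbedding = (E \ I).map σ.toEmbedding :=
    (Finset.map_sdiff _ _).symm
  simp only [IsBadSplit, Finset.card_map, ← Finset.map_inter, h]

/-- The double samples on which some member of the class has a bad split. -/
def badSamples (F : Set (X → Fin n → ℝ)) (h : (X → Fin n → ℝ) → X → Fin n) (γ δ : ℝ)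
    (m m' : ℕ) : Set (Fin (m + m') → X × Fin n) :=
  {T | ∃ f ∈ F, IsBadSplit δ (firstIndices m m') (errorIndices (h f) T) (marginIndices γ f T)}

theorem nullMeasurableSet_badSamples [MeasurableSpace X] {F : Set (X → Fin n → ℝ)}
    {h : (X → Fin n → ℝ) → X → Fin n} {γ : ℝ} {D : Measure (X × Fin n)} {m m' : ℕ} (δ : ℝ)
    (hF : IsSampleMeasurable F h γ D (m + m')) :
    NullMeasurableSet (badSamples F h γ δ m m') (Measure.pi fun _ => D) := by
  have e : badSamples F h γ δ m m' =
      ⋃ (P : Finset (Fin (m + m')) × Finset (Fin (m + m')))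
        (_ : IsBadSplit δ (firstIndices m m') P.1 P.2),
        {T : Fin (m + m') → X × Fin n | ∃ f ∈ F,
          {i | h f (T i).1 ≠ (T i).2} = (P.1 : Set (Fin (m + m'))) ∧
          {i | margin (f (T i).1) (T i).2 < γ} = (P.2 : Set (Fin (m + m')))} := by
    ext T
    simp only [badSamples, Set.mem_ofPred_eq, Set.mem_iUnion, exists_prop, Prod.exists]
    constructor
    · rintro ⟨f, hf, hb⟩
      exact ⟨_, _, hb, f, hf, by simp [errorIndices], by simp [marginIndices]⟩
    · rintro ⟨E, G, hb, f, hf, h1, h2⟩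
      refine ⟨f, hf, ?_⟩
      have e1 : errorIndices (h f) T = E := by
        rw [← Finset.coe_inj, ← h1]; simp [errorIndices]
      have e2 : marginIndices γ f T = G := by
        rw [← Finset.coe_inj, ← h2]; simp [marginIndices]
      rwa [e1, e2]
  rw [e]
  exact NullMeasurableSet.iUnion fun P => NullMeasurableSet.iUnion fun _ => hF _ _

/-- Permuting the sample amounts to keeping the index sets fixed and moving the split by `σ`. -/
theorem map_errorIndices_comp {N : ℕ} (g : X → Fin n) (T : Fin N → X × Fin n)
    (σ : Equiv.Perm (Fin N)) :
    (errorIndices g (T ∘ σ)).map σ.toEmbedding = errorIndices g T := by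
  ext i
  simp [errorIndices, Finset.mem_map_equiv]

theorem map_marginIndices_comp {N : ℕ} (γ : ℝ) (f : X → Fin n → ℝ) (T : Fin N → X × Fin n)
    (σ : Equiv.Perm (Fin N)) :
    (marginIndices γ f (T ∘ σ)).map σ.toEmbedding = marginIndices γ f T := by
  ext i
  simp [marginIndices, Finset.mem_map_equiv]

theorem card_perm_isBadSplit_le {M : ℕ} (I H : Finset (Fin M)) {δ : ℝ} (hδ : 0 ≤ δ) :
    ((Finset.univ.filter fun σ : Equiv.Perm (Fin M) =>
      IsBadSplit δ (I.map σ.toEmbedding) H H).card : ℝ) ≤ δ * M.factorial := by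
  have h := card_perm_hypTailInv_le I H hδ
  rw [Fintype.card_fin] at h
  simpa only [IsBadSplit, Finset.card_map] using h

theorem card_perm_badSamples_le {F : Set (X → Fin n → ℝ)}
    (hF : ∀ f ∈ F, ∀ x i, f x i ∈ Set.Icc (0 : ℝ) 1)
    {h : (X → Fin n → ℝ) → X → Fin n} (hh : IsArgmaxClassifier F h) {γ p δ : ℝ} (hγ : 0 < γ)
    (hp : 1 ≤ p) (hδ : 0 ≤ δ) (m m' : ℕ) (T : Fin (m + m') → X × Fin n) :
    ((Finset.univ.filter fun σ : Equiv.Perm (Fin (m + m')) =>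
      T ∘ σ ∈ badSamples F h γ δ m m').card : ℝ) ≤
      (uniformCoveringNumber p F (γ / 2 ^ (2 - 1 / p)) (m + m')).toNat *
        (δ * (m + m').factorial) := by
  set c := γ / 2 ^ (2 - 1 / p) with hc
  have hc0 : 0 < c := by positivity
  have hU := uniformCoveringNumber_ne_top hF hp hc0 (m + m')
  have hW : coveringNumber p c (restriction F fun i => (T i).1) ≤
      uniformCoveringNumber p F c (m + m') :=
    le_iSup (fun x : Fin (m + m') → X => coveringNumber p c (restriction F x)) _
  obtain ⟨W', ⟨-, hcov⟩, hcard⟩ := exists_cover_encard_eq (ne_top_of_le_ne_top hU hW)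
  have hfin : W'.Finite := by
    rw [← Set.encard_ne_top_iff, hcard]
    exact ne_top_of_le_ne_top hU hW
  set s := hfin.toFinset with hs
  have hscard : s.card ≤ (uniformCoveringNumber p F c (m + m')).toNat := by
    have : (s.card : ℕ∞) ≤ uniformCoveringNumber p F c (m + m') := by
      rw [← hfin.encard_eq_coe_toFinset_card, hcard]
      exact hW
    exact ENat.toNat_le_toNat this hU
  let H (w : Fin (m + m') → Fin n → ℝ) : Finset (Fin (m + m')) :=
    Finset.univ.filter fun i => margin (w i) (T i).2 < γ / 2
  have hsub : (Finset.univ.filter fun σ : Equiv.Perm (Fin (m + m')) =>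
      T ∘ σ ∈ badSamples F h γ δ m m') ⊆ s.biUnion fun w => Finset.univ.filter fun σ =>
        IsBadSplit δ ((firstIndices m m').map σ.toEmbedding) (H w) (H w) := by
    intro σ hσ
    obtain ⟨f, hf, hb⟩ := (Finset.mem_filter.1 hσ).2
    rw [← IsBadSplit.map σ, map_errorIndices_comp, map_marginIndices_comp] at hb
    obtain ⟨w, hw, hd⟩ := hcov _ ⟨f, hf, rfl⟩
    rw [Finset.mem_biUnion]
    refine ⟨w, hfin.mem_toFinset.2 hw, Finset.mem_filter.2 ⟨Finset.mem_univ _, hb.mono ?_ ?_⟩⟩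
    -- An error of `h f` forces margin at most 0 for `f`, hence below `γ / 2` for `w`. The other
    -- inclusion passes from `γ / 2` for `w` to `γ` for `f`.
    · intro i hi
      have hi := (Finset.mem_filter.1 hi).2
      refine Finset.mem_filter.2 ⟨Finset.mem_univ _, ?_⟩
      rw [mixedDist_comm] at hd
      have h1 := margin_lt_add_half hp hd i (T i).2
      have h2 := margin_nonpos_of_ne (hh f hf (T i).1) hi
      simp only at h1
      linarith
    · intro i hi
      have hi := (Finset.mem_filter.1 hi).2
      refine Finset.mem_filter.2 ⟨Finset.mem_univ _, ?_⟩
      have h1 := margin_lt_add_half hp hd i (T i).2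
      simp only at h1
      linarith
  calc ((Finset.univ.filter fun σ : Equiv.Perm (Fin (m + m')) =>
      T ∘ σ ∈ badSamples F h γ δ m m').card : ℝ)
      ≤ ((s.biUnion fun w => Finset.univ.filter fun σ : Equiv.Perm (Fin (m + m')) =>
        IsBadSplit δ ((firstIndices m m').map σ.toEmbedding) (H w) (H w)).card : ℝ) := by
        exact_mod_cast Finset.card_le_card hsub
    _ ≤ ∑ w ∈ s, ((Finset.univ.filter fun σ : Equiv.Perm (Fin (m + m')) =>
        IsBadSplit δ ((firstIndices m m').map σ.toEmbedding) (H w) (H w)).card : ℝ) := by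
        exact_mod_cast Finset.card_biUnion_le
    _ ≤ ∑ _w ∈ s, δ * (m + m').factorial :=
        Finset.sum_le_sum fun w _ => card_perm_isBadSplit_le _ _ hδ
    _ = s.card * (δ * (m + m').factorial) := by rw [Finset.sum_const, nsmul_eq_mul]
    _ ≤ _ := by gcongr

/-- If `Q` contains at most a fraction `c` of the permutations of every sample, then its
probability under an i.i.d. sample is at most `c`. -/
theorem measure_le_of_card_perm_le {Z ι : Type*} [MeasurableSpace Z] [Fintype ι]
    [DecidableEq ι] (D : Measure Z) [IsProbabilityMeasure D] {Q : Set (ι → Z)}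
    (hQ : NullMeasurableSet Q (Measure.pi fun _ => D)) {c : ℝ} (hc : 0 ≤ c)
    (h : ∀ T : ι → Z, ((Finset.univ.filter fun σ : Equiv.Perm ι => T ∘ σ ∈ Q).card : ℝ) ≤
      c * (Fintype.card ι).factorial) :
    (Measure.pi fun _ => D).real Q ≤ c := by
  set μ : Measure (ι → Z) := Measure.pi fun _ => D
  have hσ (σ : Equiv.Perm ι) : NullMeasurableSet ((fun T : ι → Z => T ∘ σ) ⁻¹' Q) μ :=
    hQ.preimage (measurePreserving_comp_perm D σ).quasiMeasurePreserving
  -- All permuted copies of `Q` have the same measure, so summing their indicators counts `μ Q` once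
  -- per permutation.
  have h1 : ((Fintype.card ι).factorial : ENNReal) * μ Q =
      ∫⁻ T, ∑ σ : Equiv.Perm ι, ((fun T : ι → Z => T ∘ σ) ⁻¹' Q).indicator 1 T ∂μ := by
    have hi (σ : Equiv.Perm ι) :
        AEMeasurable (((fun T : ι → Z => T ∘ σ) ⁻¹' Q).indicator (1 : (ι → Z) → ENNReal)) μ :=
      (aemeasurable_indicator_const_iff 1).2 (hσ σ)
    rw [lintegral_finsetSum' _ fun σ _ => hi σ]
    have hμ (σ : Equiv.Perm ι) : ∫⁻ T, ((fun T : ι → Z => T ∘ σ) ⁻¹' Q).indicator 1 T ∂μ = μ Q := by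
      rw [lintegral_indicator_one₀ (hσ σ), (measurePreserving_comp_perm D σ).measure_preimage hQ]
    rw [Finset.sum_congr rfl fun σ _ => hμ σ, Finset.sum_const, Finset.card_univ, Fintype.card_perm, nsmul_eq_mul]
  have h2 : ((Fintype.card ι).factorial : ENNReal) * μ Q ≤
      ENNReal.ofReal (c * (Fintype.card ι).factorial) := by
    rw [h1]
    calc _ ≤ ∫⁻ _T, ENNReal.ofReal (c * (Fintype.card ι).factorial) ∂μ := by
          refine lintegral_mono fun T => ?_
          simp only [Set.indicator_apply, Set.mem_preimage, Pi.one_apply]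
          rw [Finset.sum_boole, ← ENNReal.ofReal_natCast]
          exact ENNReal.ofReal_le_ofReal (h T)
      _ = _ := by simp
  have h3 := ENNReal.toReal_mono ENNReal.ofReal_ne_top h2
  rw [ENNReal.toReal_mul, ENNReal.toReal_natCast, ENNReal.toReal_ofReal (by positivity),
    mul_comm] at h3
  exact le_of_mul_le_mul_right h3 (by exact_mod_cast Nat.factorial_pos _)

theorem card_firstIndices_inter_marginIndices {m m' : ℕ} (γ : ℝ) (f : X → Fin n → ℝ)
    (S : Fin m → X × Fin n) (S' : Fin m' → X × Fin n) :
    (firstIndices m m' ∩ marginIndices γ f (Fin.append S S')).card = marginErrors γ S f := by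
  have e : firstIndices m m' ∩ marginIndices γ f (Fin.append S S') =
      (marginIndices γ f S).map (Fin.castAddEmb m') := by
    ext i
    refine Fin.addCases (fun i => ?_) (fun i => ?_) i
    · simp [firstIndices, marginIndices]
    · simp [firstIndices, marginIndices, Fin.ext_iff]
      omega
  rw [e, Finset.card_map, marginErrors, Set.ncard_eq_toFinset_card', marginIndices]
  congr 1
  ext i
  simp

theorem card_errorIndices_sdiff_firstIndices {m m' : ℕ} (g : X → Fin n)
    (S : Fin m → X × Fin n) (S' : Fin m' → X × Fin n) :
    (errorIndices g (Fin.append S S') \ firstIndices m m').card = (errorIndices g S').card := by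
  have e : errorIndices g (Fin.append S S') \ firstIndices m m' =
      (errorIndices g S').map (Fin.natAddEmb m) := by
    ext i
    refine Fin.addCases (fun i => ?_) (fun i => ?_) i
    · simp [firstIndices, errorIndices, Fin.ext_iff]
      intros
      omega
    · simp only [errorIndices, firstIndices, Finset.mem_sdiff, Finset.mem_filter, Finset.mem_univ,
        true_and, Fin.append_right, Finset.mem_map, Fin.natAddEmb_apply, Fin.natAdd_inj,
        exists_eq_right, and_iff_left_iff_imp]
      rintro - ⟨a, ha⟩
      simp [Fin.ext_iff] at ha
      omega
  rw [e, Finset.card_map]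

/-- If the risk exceeds the bound on the sample `S`, then a ghost sample of size `m'` reveals this
with probability more than `1 / 4`. -/
theorem one_fourth_lt_measureReal_append_mem_badSamples [MeasurableSpace X]
    {F : Set (X → Fin n → ℝ)} {h : (X → Fin n → ℝ) → X → Fin n} {f : X → Fin n → ℝ} (hf : f ∈ F)
    (hmeas : Measurable (h f)) (D : Measure (X × Fin n)) [IsProbabilityMeasure D] {γ δ : ℝ}
    {m m' : ℕ} (hm' : 0 < m') (S : Fin m → X × Fin n) (hk : marginErrors γ S f ≠ m)
    (hrisk : 1 / (m' : ℝ) * max 1 ((hypTailInv (marginErrors γ S f) m δ (m + m') : ℝ) - 1 -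
      marginErrors γ S f) < trueRisk D (h f)) :
    1 / 4 < (Measure.pi fun _ : Fin m' => D).real
      {S' | Fin.append S S' ∈ badSamples F h γ δ m m'} := by
  set k := marginErrors γ S f with hkdef
  have hm'0 : (0 : ℝ) < m' := by exact_mod_cast hm'
  have hkm : k < m := by
    refine lt_of_le_of_ne ?_ hk
    have := Set.ncard_le_card {i : Fin m | margin (f (S i).1) (S i).2 < γ}
    rwa [Nat.card_eq_fintype_card, Fintype.card_fin] at this
  set B := hypTailInv k m δ (m + m') with hB
  -- The subtraction is truncated, but the maximum with 1 hides this. That maximum also supplies `0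
  -- < t` for the binomial bound.
  set t := max 1 (B - 1 - k) with ht
  have htB : (t : ℝ) ≤ max 1 ((B : ℝ) - 1 - k) := by
    rcases le_or_gt (1 + k) B with hle | hlt
    · rw [ht, Nat.cast_max, Nat.cast_one, Nat.sub_sub, Nat.cast_sub hle]
      push_cast
      rw [sub_sub]
    · rw [ht, show B - 1 - k = 0 by omega]
      simp
  have htR : (t : ℝ) / m' < D.real {z | h f z.1 ≠ z.2} := by
    refine lt_of_le_of_lt ?_ hrisk
    rw [div_eq_inv_mul, one_div]
    gcongr
  have hA : MeasurableSet {z : X × Fin n | h f z.1 ≠ z.2} :=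
    (measurableSet_eq_fun (hmeas.comp measurable_fst) measurable_snd).compl
  have hbin := binomialCdf_lt hm' (show 0 < t by omega) htR measureReal_le_one
  rw [← measureReal_card_le_eq_binomialCdf D hA] at hbin
  set L := {S' : Fin m' → X × Fin n | (errorIndices (h f) S').card ≤ t} with hL
  have hbin : (Measure.pi fun _ : Fin m' => D).real L < 3 / 4 := by
    convert hbin using 6
    ext i
    simp [errorIndices]
  have hcompl : Lᶜ ⊆ {S' | Fin.append S S' ∈ badSamples F h γ δ m m'} := by
    intro S' hS'
    -- Strictness absorbs the `- 1` in `t`: at least `t + 1 ≥ B - k` ghost errors.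
    have hS' : t < (errorIndices (h f) S').card := not_le.1 hS'
    refine ⟨f, hf, k, by rwa [card_firstIndices], ?_, ?_⟩
    · rw [card_firstIndices_inter_marginIndices]
    · rw [card_firstIndices, card_errorIndices_sdiff_firstIndices]
      omega
  have h1 : 1 ≤ (Measure.pi fun _ : Fin m' => D).real L +
      (Measure.pi fun _ : Fin m' => D).real Lᶜ := by
    have := measureReal_union_le (μ := Measure.pi fun _ : Fin m' => D) L Lᶜ
    rwa [Set.union_compl_self, probReal_univ] at this
  have h2 := measureReal_mono (μ := Measure.pi fun _ : Fin m' => D) hcompl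
  linarith

end Symmetrization

/-! ### Markov's inequality over the first sample, and the conclusion -/

/-- If `Q` has probability at most `c * δ`, then a measurable event of probability more than
`1 - δ` contains no sample `S` whose section of `Q` has outer probability more than `c`. -/
theorem exists_measurableSet_compl_of_append {Z : Type*} [MeasurableSpace Z] (D : Measure Z)
    [IsProbabilityMeasure D] {m m' : ℕ} (Q : Set (Fin (m + m') → Z)) {c δ : ℝ} (hc : 0 < c)
    (hδ : 0 < δ) (hQ : (Measure.pi fun _ => D).real Q ≤ c * δ) :
    ∃ A : Set (Fin m → Z), MeasurableSet A ∧
      (∀ S, c < (Measure.pi fun _ : Fin m' => D).real {S' | Fin.append S S' ∈ Q} → S ∉ A) ∧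
      1 - δ < (Measure.pi fun _ : Fin m => D).real A := by
  -- A measurable hull makes the section measure a measurable function of `S`, at no cost in
  -- probability.
  set Q' := toMeasurable (Measure.pi fun _ => D) Q with hQ'
  have hQ'm : MeasurableSet Q' := measurableSet_toMeasurable _ _
  have hpres := measurePreserving_append D m m'
  have hpre := hpres.measurable hQ'm
  let g : (Fin m → Z) → ENNReal := fun S =>
    (Measure.pi fun _ : Fin m' => D) {S' | Fin.append S S' ∈ Q'}
  have hg : Measurable g := measurable_measure_prodMk_left hpre
  have hgQ : ∫⁻ S, g S ∂(Measure.pi fun _ : Fin m => D) = Measure.pi (fun _ => D) Q := by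
    rw [← measure_toMeasurable Q, ← hpres.measure_preimage hQ'm.nullMeasurableSet,
      Measure.prod_apply hpre]
    rfl
  set C : Set (Fin m → Z) := {S | ENNReal.ofReal c < g S} with hC
  have hCm : MeasurableSet C := measurableSet_lt measurable_const hg
  refine ⟨Cᶜ, hCm.compl, fun S hS hSC => hSC ?_, ?_⟩
  · rw [hC, Set.mem_ofPred_eq, ENNReal.ofReal_lt_iff_lt_toReal hc.le (measure_ne_top _ _)]
    refine hS.trans_le (measureReal_mono fun S' hS' => ?_)
    exact subset_toMeasurable _ _ hS'
  · rw [probReal_compl_eq_one_sub hCm]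
    refine sub_lt_sub_left ?_ 1
    -- Markov's inequality is strict unless the exceptional set is null, where `0 < δ` suffices;
    -- hence the strict conclusion.
    rcases eq_or_ne (Measure.pi (fun _ : Fin m => D) C) 0 with h0 | h0
    · rwa [Measure.real, h0, ENNReal.toReal_zero]
    have hlt : ENNReal.ofReal c * Measure.pi (fun _ : Fin m => D) C <
        Measure.pi (fun _ => D) Q := by
      rw [← setLIntegral_const, ← hgQ]
      refine lt_of_lt_of_le ?_ (setLIntegral_le_lintegral C g)
      refine setLIntegral_strict_mono hCm h0 hg ?_ (Filter.Eventually.of_forall fun S hS => hS)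
      rw [setLIntegral_const]
      exact ENNReal.mul_ne_top ENNReal.ofReal_ne_top (measure_ne_top _ _)
    have h1 := (ENNReal.toReal_lt_toReal (ne_top_of_lt hlt) (measure_ne_top _ _)).2 hlt
    rw [ENNReal.toReal_mul, ENNReal.toReal_ofReal hc.le] at h1
    exact lt_of_mul_lt_mul_left (h1.trans_le hQ) hc.le

theorem theorem2 {X : Type*} [MeasurableSpace X] {n : ℕ}
    (F : Set (X → Fin n → ℝ)) (hF : ∀ f ∈ F, ∀ x i, f x i ∈ Set.Icc (0 : ℝ) 1)
    (h : (X → Fin n → ℝ) → X → Fin n) (hh : IsArgmaxClassifier F h)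
    (h_meas : ∀ f ∈ F, Measurable (h f))
    (D : Measure (X × Fin n)) [IsProbabilityMeasure D]
    (δ : ℝ) (hδ : δ ∈ Set.Ioo (0 : ℝ) 1) (γ : ℝ) (hγ : γ ∈ Set.Ioo (0 : ℝ) 1)
    (p : ℝ) (hp : 1 ≤ p) (m m' : ℕ) (hm : 0 < m) (hm' : 0 < m')
    (hF_meas : IsSampleMeasurable F h γ D (m + m')) :
    -- the event contains a measurable set of probability greater than `1 - δ`
    ∃ A : Set (Fin m → X × Fin n), MeasurableSet A ∧
      A ⊆ {S | ∀ f ∈ F,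
        trueRisk D (h f) ≤ marginEps F p γ m' (marginErrors γ S f) m δ} ∧
      1 - δ < (Measure.pi fun _ : Fin m => D).real A := by

  set N := (uniformCoveringNumber p F (γ / 2 ^ (2 - 1 / p)) (m + m')).toNat with hN
  have hδ' : 0 ≤ δ / (4 * (N : ℝ)) := div_nonneg hδ.1.le (by positivity)
  have hQ : (Measure.pi fun _ => D).real (badSamples F h γ (δ / (4 * (N : ℝ))) m m') ≤
      1 / 4 * δ := by
    have hNδ : N * (δ / (4 * (N : ℝ))) ≤ 1 / 4 * δ := by
      -- For `N = 0`, as for an empty class, the level `δ / (4 * N)` is 0 by convention and the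
      -- bound is trivial.
      rcases Nat.eq_zero_or_pos N with h0 | h0
      · rw [h0, Nat.cast_zero, zero_mul]
        linarith [hδ.1]
      · have : (0 : ℝ) < N := by exact_mod_cast h0
        refine le_of_eq ?_
        field_simp
    refine measure_le_of_card_perm_le D (nullMeasurableSet_badSamples _ hF_meas)
      (by linarith [hδ.1]) fun T => ?_
    refine (card_perm_badSamples_le hF hh hγ.1 hp hδ' m m' T).trans ?_
    rw [← mul_assoc, Fintype.card_fin]
    exact mul_le_mul_of_nonneg_right hNδ (Nat.cast_nonneg _)
  obtain ⟨A, hAm, hA, hAδ⟩ := exists_measurableSet_compl_of_append D _ (by norm_num) hδ.1 hQ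
  refine ⟨A, hAm, fun S hS f hf => ?_, hAδ⟩
  by_contra hlt
  rw [not_le, marginEps] at hlt
  split_ifs at hlt with hk
  · exact hlt.not_ge measureReal_le_one
  · exact hA S (one_fourth_lt_measureReal_append_mem_badSamples hf (h_meas f hf) D hm' S hk hlt) hS
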